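/- Let $k$ be a field of characteristic zero, let $R=k[x_0,x_1,x_2,x_3]$, and let $F=L_1\cdots L_d\in R$ be a product of pairwise linearly independent nonzero linear forms, so that $F$ defines an arrangement of $d$ distinct planes in $\mathbb P^3$. Let $J=\langle \partial F/\partial x_0,\dots,\partial F/\partial x_3\rangle$ be the Jacobian ideal of $F$, and let $\sqrt J=\bigcap_i\mathfrak p_i$, where the $\mathfrak p_i$ are the distinct minimal primes of $J$. For each $i$ let $a_i$ be the number of indices $j$ with $L_j\in\mathfrak p_i$. Choose integers $b_i$ such that $b_i=1$ if $a_i=2$, and $0\le b_i\le a_i$ otherwise (with the convention $\mathfrak p_i^0=R$). Assume that no factor $L_j$ of $F$ lies in two distinct $\mathfrak p_i$ with $a_i\ge 3$. Then the ring $R/\bigcap_i\mathfrak p_i^{b_i}$ is Cohen–Macaulay (the zero ring being regarded as Cohen–Macaulay). -/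

import Mathlib

/-- A local ring `A` is Cohen–Macaulay if it is Noetherian and its depth equals its Krull dimension,
i.e. some `A`-regular sequence has length `dim A`. (`RingTheory.Sequence.IsRegular` includes
`(r₁, …, rₙ) ≠ A`, so the terms of the sequence lie in the maximal ideal; and no regular sequence is
longer than `dim A`.) -/
structure IsCohenMacaulayLocalRing (A : Type*) [CommRing A] [IsLocalRing A] : Prop where
  isNoetherianRing : IsNoetherianRing A
  exists_isRegular : ∃ rs : List A,
    RingTheory.Sequence.IsRegular A rs ∧ ((rs.length : ℕ∞) : WithBot ℕ∞) = ringKrullDim A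

/-- A commutative ring is Cohen–Macaulay if it is Noetherian and all its localizations at maximal
ideals are Cohen–Macaulay local rings. (As usual, the zero ring is Cohen–Macaulay.) -/
structure IsCohenMacaulayRing (A : Type*) [CommRing A] : Prop where
  isNoetherianRing : IsNoetherianRing A
  localization_atMaximal : ∀ (m : Ideal A) [m.IsMaximal],
    IsCohenMacaulayLocalRing (Localization.AtPrime m)

namespace PlaneArrangement

/-- The homogeneous coordinate ring `k[x₀, x₁, x₂, x₃]` of `ℙ³`. -/
abbrev CoordRing (k : Type*) [Field k] : Type _ := MvPolynomial (Fin 4) k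

variable {k : Type*} [Field k] {d : ℕ}

/-- The forms `L 0, …, L (d - 1)` define an arrangement of `d` distinct planes in `ℙ³`: they are
nonzero linear forms, pairwise linearly independent. -/
structure IsArrangement (L : Fin d → CoordRing k) : Prop where
  isHomogeneous : ∀ i, (L i).IsHomogeneous 1
  ne_zero : ∀ i, L i ≠ 0
  linearIndependent : ∀ i j, i ≠ j → LinearIndependent k ![L i, L j]

/-- The Jacobian ideal of `F`, generated by its partial derivatives. -/
noncomputable def jacobianIdeal (F : CoordRing k) : Ideal (CoordRing k) :=
  Ideal.span (Set.range fun j : Fin 4 => MvPolynomial.pderiv j F)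

/-- The Jacobian ideal `J` of the arrangement, that is, of the product `F = ∏ i, L i`. -/
noncomputable def arrangementIdeal (L : Fin d → CoordRing k) : Ideal (CoordRing k) :=
  jacobianIdeal (∏ i, L i)

/-- The number of factors of `F = ∏ i, L i` that lie in the ideal `p`. -/
noncomputable def numFactors (L : Fin d → CoordRing k) (p : Ideal (CoordRing k)) : ℕ :=
  {i : Fin d | L i ∈ p}.ncard

/-- The ideal `⋂ pᵢ ^ bᵢ`, where `pᵢ` runs over the minimal primes of `J`, i.e. over the components
in the irredundant prime decomposition `√J = ⋂ pᵢ`; here `p ^ 0` is the unit ideal. -/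
noncomputable def fatIdeal (L : Fin d → CoordRing k) (b : Ideal (CoordRing k) → ℕ) :
    Ideal (CoordRing k) :=
  ⨅ p ∈ (arrangementIdeal L).minimalPrimes, p ^ b p

end PlaneArrangement

/-! Let `k[y]` be the polynomial ring in `card σ - 2` linear forms `y`, so generic that together
with any two of the factors `L i`, `L j` they generate the polynomial ring `R`. Then `R` is a
polynomial ring over `k[y]` in the variables `L i`, `L j`, so for `p = (L i, L j)` all `R ⧸ p ^ n`
are free over `k[y]` and `R ⧸ p` is `k[y]` itself. The minimal primes of the Jacobian ideal are
these `p`.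

Colour each factor by the multiple line that it contains, giving each remaining factor a colour of
its own. The product of the factors of colour `p` lies in `p ^ b p`, as `b p` is at most their
number, and two factors of distinct colours meet in a line that lies on no third factor. For
`G ∈ A` and `F ∈ B` with `F` regular modulo `A` and `G` regular modulo `B`, liaison addition is
the exact sequence `0 → R ⧸ A × R ⧸ B → R ⧸ (A ⊓ B ⊓ (F, G)) → R ⧸ (F, G) → 0`. Iterating it over
the colours shows that `R ⧸ ⨅ p, p ^ b p` is projective over `k[y]`.

This quotient is also integral over `k[y]`, and a Noetherian ring that is flat and integral over a
polynomial ring over a field is Cohen–Macaulay, because regular sequences stay regular under flat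
extensions. -/

section CohenMacaulay

open RingTheory.Sequence

theorem isCohenMacaulayRing_of_subsingleton (A : Type*) [CommRing A] [Subsingleton A] :
    IsCohenMacaulayRing A :=
  ⟨inferInstance, fun _ hm => (hm.ne_top (Subsingleton.elim _ _)).elim⟩

/-- Every maximal ideal of `A` contains a weakly regular sequence of length `n`; for a Noetherian
ring this says that all its localizations at maximal ideals have depth at least `n`. -/
def MaximalDepthGE (A : Type*) [CommRing A] (n : ℕ) : Prop :=
  ∀ m : Ideal A, m.IsMaximal → ∃ rs : List A,
    rs.length = n ∧ (∀ r ∈ rs, r ∈ m) ∧ IsWeaklyRegular A rs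

theorem MaximalDepthGE.isCohenMacaulayRing {A : Type*} [CommRing A] [IsNoetherianRing A] {n : ℕ}
    (h : MaximalDepthGE A n) (hdim : ringKrullDim A ≤ n) : IsCohenMacaulayRing A where
  isNoetherianRing := inferInstance
  localization_atMaximal m hm := by
    obtain ⟨rs, rfl, hrs, hreg⟩ := h m hm
    have hloc := hreg.isRegular_of_isLocalization_of_mem (Localization.AtPrime m) m hrs
    refine ⟨inferInstance, _, hloc, ?_⟩
    have hle : ringKrullDim (Localization.AtPrime m) ≤ rs.length :=
      (IsLocalization.AtPrime.ringKrullDim_eq_height m (Localization.AtPrime m)).le.trans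
        (Ideal.height_le_ringKrullDim_of_isPrime.trans hdim)
    have hnontrivial : Nontrivial (Localization.AtPrime m ⧸
        Ideal.ofList (rs.map (algebraMap A (Localization.AtPrime m)))) :=
      Ideal.Quotient.nontrivial_iff.2 fun htop => hloc.top_ne_smul (by simp [htop])
    rw [List.length_map]
    refine le_antisymm ?_ hle
    rw [← ringKrullDim_add_length_eq_ringKrullDim_of_isRegular _ hloc, List.length_map]
    exact le_add_of_nonneg_left ringKrullDim_nonneg_of_nontrivial

theorem MaximalDepthGE.of_flat {A B : Type*} [CommRing A] [CommRing B] [Algebra A B]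
    [Module.Flat A B] [Algebra.IsIntegral A B] {n : ℕ} (h : MaximalDepthGE A n) :
    MaximalDepthGE B n := by
  intro m hm
  obtain ⟨rs, rfl, hrs, hreg⟩ := h _ (Ideal.isMaximal_comap_of_isIntegral_of_isMaximal (R := A) m)
  exact ⟨rs.map (algebraMap A B), List.length_map .., by simpa using hrs, hreg.of_flat⟩

theorem MaximalDepthGE.of_ringEquiv {A B : Type*} [CommRing A] [CommRing B] (e : A ≃+* B) {n : ℕ}
    (h : MaximalDepthGE A n) : MaximalDepthGE B n := by
  let := e.toRingHom.toAlgebra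
  have : Module.Flat A B := RingHom.Flat.of_bijective e.bijective
  have : Algebra.IsIntegral A B := ⟨e.toRingHom.isIntegral_of_surjective e.surjective⟩
  exact h.of_flat

theorem exists_monic_mem_of_isMaximal {A : Type*} [CommRing A] [IsJacobsonRing A]
    (m : Ideal (Polynomial A)) [m.IsMaximal] : ∃ f ∈ m, f.Monic := by
  obtain ⟨f, hf, hfm⟩ :=
    Polynomial.quotient_mk_comp_C_isIntegral_of_isJacobsonRing m (Ideal.Quotient.mk m Polynomial.X)
  rw [← Polynomial.hom_eval₂, Polynomial.eval₂_C_X, Ideal.Quotient.eq_zero_iff_mem] at hfm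
  exact ⟨f, hfm, hf⟩

theorem isSMulRegular_quotient_map_C_of_monic {A : Type*} [CommRing A] (I : Ideal A)
    {f : Polynomial A} (hf : f.Monic) :
    IsSMulRegular (Polynomial A ⧸ I.map Polynomial.C) f := by
  rw [isSMulRegular_quotient_iff_mem_of_smul_mem]
  intro g hg
  have hmap : I.map Polynomial.C = RingHom.ker (Polynomial.mapRingHom (Ideal.Quotient.mk I)) := by
    rw [Polynomial.ker_mapRingHom, Ideal.mk_ker]
  rw [hmap, RingHom.mem_ker] at hg ⊢
  rw [smul_eq_mul, map_mul] at hg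
  exact (hf.map _).mul_right_eq_zero_iff.1 hg

theorem MaximalDepthGE.polynomial {A : Type*} [CommRing A] [IsJacobsonRing A] {n : ℕ}
    (h : MaximalDepthGE A n) : MaximalDepthGE (Polynomial A) (n + 1) := by
  intro m hm
  obtain ⟨rs, rfl, hrs, hreg⟩ := h _ (Polynomial.isMaximal_comap_C_of_isJacobsonRing m)
  obtain ⟨f, hfm, hf⟩ := exists_monic_mem_of_isMaximal m
  refine ⟨rs.map (algebraMap A (Polynomial A)) ++ [f], by simp, ?_, ?_⟩
  · simpa [or_imp, forall_and] using ⟨hrs, hfm⟩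
  · rw [isWeaklyRegular_append_iff, isWeaklyRegular_singleton_iff, ← Ideal.map_ofList,
      smul_eq_mul, Ideal.mul_top]
    exact ⟨hreg.of_flat, isSMulRegular_quotient_map_C_of_monic _ hf⟩

theorem maximalDepthGE_mvPolynomial (k : Type*) [Field k] :
    ∀ n, MaximalDepthGE (MvPolynomial (Fin n) k) n
  | 0 => fun m _ => ⟨[], rfl, by simp, .nil _ _⟩
  | n + 1 => (maximalDepthGE_mvPolynomial k n).polynomial.of_ringEquiv
      (MvPolynomial.finSuccEquiv k n).symm.toRingEquiv

theorem ringKrullDim_le_of_isIntegral (A B : Type*) [CommRing A] [CommRing B] [Algebra A B]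
    [Algebra.IsIntegral A B] : ringKrullDim B ≤ ringKrullDim A :=
  Order.krullDim_le_of_strictMono (PrimeSpectrum.comap (algebraMap A B)) fun p _ hpq =>
    Ideal.IsIntegral.comap_lt_comap (I := p.asIdeal) hpq

theorem isCohenMacaulayRing_of_flat_of_isIntegral (k : Type*) [Field k] (n : ℕ) (B : Type*)
    [CommRing B] [IsNoetherianRing B] [Algebra (MvPolynomial (Fin n) k) B]
    [Module.Flat (MvPolynomial (Fin n) k) B] [Algebra.IsIntegral (MvPolynomial (Fin n) k) B] :
    IsCohenMacaulayRing B := by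
  refine (maximalDepthGE_mvPolynomial k n).of_flat.isCohenMacaulayRing (A := B) ?_
  refine (ringKrullDim_le_of_isIntegral (MvPolynomial (Fin n) k) B).trans ?_
  rw [MvPolynomial.ringKrullDim_of_isNoetherianRing, ringKrullDim_eq_zero_of_field, zero_add,
    Nat.card_fin]

end CohenMacaulay

theorem projective_of_exact {S M N P : Type*} [Ring S] [AddCommGroup M] [AddCommGroup N]
    [AddCommGroup P] [Module S M] [Module S N] [Module S P] [Module.Projective S M]
    [Module.Projective S P] {f : M →ₗ[S] N} {g : N →ₗ[S] P} (hf : Function.Injective f)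
    (hfg : Function.Exact f g) (hg : Function.Surjective g) : Module.Projective S N := by
  obtain ⟨s, hs⟩ := Module.projective_lifting_property g .id hg
  exact .of_equiv (hfg.splitSurjectiveEquiv hf ⟨s, hs⟩).1.symm

section Liaison

open Ideal

variable {S R ι κ : Type*} [CommRing S] [CommRing R] [Algebra S R]

theorem isSMulRegular_quotient_iff {I : Ideal R} {r : R} :
    IsSMulRegular (R ⧸ I) r ↔ ∀ x, r * x ∈ I → x ∈ I :=
  isSMulRegular_quotient_iff_mem_of_smul_mem I r

theorem isSMulRegular_quotient_inf {I J : Ideal R} {r : R} (hI : IsSMulRegular (R ⧸ I) r)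
    (hJ : IsSMulRegular (R ⧸ J) r) : IsSMulRegular (R ⧸ I ⊓ J) r := by
  rw [isSMulRegular_quotient_iff] at *
  exact fun x hx => ⟨hI x hx.1, hJ x hx.2⟩

theorem isSMulRegular_quotient_iInf {α : Sort*} {I : α → Ideal R} {r : R}
    (h : ∀ a, IsSMulRegular (R ⧸ I a) r) : IsSMulRegular (R ⧸ ⨅ a, I a) r := by
  simp only [isSMulRegular_quotient_iff, Ideal.mem_iInf] at *
  exact fun x hx a => h a x (hx a)

theorem isSMulRegular_prod {M : Type*} [AddCommGroup M] [Module R M] {s : Finset ι} {f : ι → R}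
    (h : ∀ i ∈ s, IsSMulRegular M (f i)) : IsSMulRegular M (∏ i ∈ s, f i) :=
  Finset.prod_induction f (IsSMulRegular M) (fun _ _ => .mul) (.one M) h

theorem span_pair_le_iff {a b : R} {I : Ideal R} : span {a, b} ≤ I ↔ a ∈ I ∧ b ∈ I :=
  span_le.trans Set.pair_subset_iff

theorem left_mem_span_pair (a b : R) : a ∈ span {a, b} := (span_pair_le_iff.1 le_rfl).1

theorem right_mem_span_pair (a b : R) : b ∈ span {a, b} := (span_pair_le_iff.1 le_rfl).2

theorem linearCombination_mem_inf_iff {A B : Ideal R} {F G : R} (hGA : G ∈ A) (hFB : F ∈ B)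
    (hF : IsSMulRegular (R ⧸ A) F) (hG : IsSMulRegular (R ⧸ B) G) {a b : R} :
    F * a + G * b ∈ A ⊓ B ↔ a ∈ A ∧ b ∈ B := by
  rw [isSMulRegular_quotient_iff] at hF hG
  rw [Submodule.mem_inf, A.add_mem_iff_left (A.mul_mem_right b hGA),
    B.add_mem_iff_right (B.mul_mem_right a hFB)]
  exact and_congr ⟨hF a, A.mul_mem_left F⟩ ⟨hG b, B.mul_mem_left G⟩

/- The maps are `(a, b) ↦ F a + G b` and the projection. -/
theorem exists_exact_quotient_inf_inf_span {A B : Ideal R} {F G : R} (hGA : G ∈ A) (hFB : F ∈ B)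
    (hF : IsSMulRegular (R ⧸ A) F) (hG : IsSMulRegular (R ⧸ B) G) :
    ∃ (f : (R ⧸ A) × (R ⧸ B) →ₗ[R] R ⧸ A ⊓ B ⊓ span {F, G})
      (g : (R ⧸ A ⊓ B ⊓ span {F, G}) →ₗ[R] R ⧸ span {F, G}),
      Function.Injective f ∧ Function.Exact f g ∧ Function.Surjective g := by
  set I := A ⊓ B ⊓ span {F, G} with hI
  have mem_I {a b : R} : F * a + G * b ∈ I ↔ a ∈ A ∧ b ∈ B := by
    rw [hI, Submodule.mem_inf, linearCombination_mem_inf_iff hGA hFB hF hG, and_iff_left]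
    exact Ideal.mem_span_pair.2 ⟨a, b, by ring⟩
  have hA : A ≤ Submodule.comap (LinearMap.mulLeft R F) I := fun a ha => by
    simpa using mem_I.2 ⟨ha, B.zero_mem⟩
  have hB : B ≤ Submodule.comap (LinearMap.mulLeft R G) I := fun b hb => by
    simpa using mem_I.2 ⟨A.zero_mem, hb⟩
  let f : (R ⧸ A) × (R ⧸ B) →ₗ[R] R ⧸ I :=
    (Submodule.mapQ A I (.mulLeft R F) hA).coprod (Submodule.mapQ B I (.mulLeft R G) hB)
  have f_mk (a b : R) : f (Ideal.Quotient.mk A a, Ideal.Quotient.mk B b) =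
      Ideal.Quotient.mk I (F * a + G * b) := rfl
  let g : R ⧸ I →ₗ[R] R ⧸ span {F, G} := Submodule.factor inf_le_right
  refine ⟨f, g, ?_, ?_, Submodule.factor_surjective inf_le_right⟩
  · refine (injective_iff_map_eq_zero f).2 ?_
    rintro ⟨a, b⟩ hab
    obtain ⟨a, rfl⟩ := Ideal.Quotient.mk_surjective a
    obtain ⟨b, rfl⟩ := Ideal.Quotient.mk_surjective b
    rw [f_mk, Ideal.Quotient.eq_zero_iff_mem, mem_I] at hab
    exact Prod.ext (Ideal.Quotient.eq_zero_iff_mem.2 hab.1) (Ideal.Quotient.eq_zero_iff_mem.2 hab.2)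
  · intro x
    obtain ⟨x, rfl⟩ := Ideal.Quotient.mk_surjective x
    refine Ideal.Quotient.eq_zero_iff_mem.trans ⟨fun hx => ?_, ?_⟩
    · obtain ⟨a, b, rfl⟩ := Ideal.mem_span_pair.1 hx
      exact ⟨(Ideal.Quotient.mk A a, Ideal.Quotient.mk B b), by simp [f_mk, mul_comm]⟩
    · rintro ⟨⟨a, b⟩, hab⟩
      obtain ⟨a, rfl⟩ := Ideal.Quotient.mk_surjective a
      obtain ⟨b, rfl⟩ := Ideal.Quotient.mk_surjective b
      have hx : F * a + G * b - x ∈ I := Ideal.Quotient.eq.1 hab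
      have hmem : F * a + G * b ∈ span {F, G} := Ideal.mem_span_pair.2 ⟨a, b, by ring⟩
      simpa using Ideal.sub_mem _ hmem hx.2

theorem projective_quotient_inf_inf_span {A B : Ideal R} {F G : R} (hGA : G ∈ A) (hFB : F ∈ B)
    (hF : IsSMulRegular (R ⧸ A) F) (hG : IsSMulRegular (R ⧸ B) G) [Module.Projective S (R ⧸ A)]
    [Module.Projective S (R ⧸ B)] [Module.Projective S (R ⧸ span {F, G})] :
    Module.Projective S (R ⧸ A ⊓ B ⊓ span {F, G}) := by
  obtain ⟨f, g, hf, hfg, hg⟩ := exists_exact_quotient_inf_inf_span hGA hFB hF hG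
  exact projective_of_exact (f := f.restrictScalars S) (g := g.restrictScalars S) hf hfg hg

theorem projective_quotient_inf_span {A : Ideal R} {F G : R} (hGA : G ∈ A)
    (hF : IsSMulRegular (R ⧸ A) F) [Module.Projective S (R ⧸ A)]
    [Module.Projective S (R ⧸ span {F, G})] : Module.Projective S (R ⧸ A ⊓ span {F, G}) := by
  have hG : IsSMulRegular (R ⧸ (⊤ : Ideal R)) G := Function.injective_of_subsingleton _
  have := projective_quotient_inf_inf_span (S := S) hGA Submodule.mem_top hF hG
  rwa [inf_top_eq] at this

theorem span_mul_pair_eq_inf {a b G : R} (h : IsSMulRegular (R ⧸ span {a, G}) b) :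
    span {a * b, G} = span {a, G} ⊓ span {b, G} := by
  refine le_antisymm (le_inf ?_ ?_) fun x ⟨hxa, hxb⟩ => ?_
  · exact span_pair_le_iff.2 ⟨mul_mem_right b _ (left_mem_span_pair a G), right_mem_span_pair a G⟩
  · exact span_pair_le_iff.2 ⟨mul_mem_left _ a (left_mem_span_pair b G), right_mem_span_pair b G⟩
  · obtain ⟨u, v, rfl⟩ := mem_span_pair.1 hxb
    rw [SetLike.mem_coe, Ideal.add_mem_iff_left _ (mul_mem_left _ v (right_mem_span_pair a G)),
      mul_comm] at hxa
    obtain ⟨u', v', rfl⟩ := mem_span_pair.1 (isSMulRegular_quotient_iff.1 h u hxa)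
    exact mem_span_pair.2 ⟨u', v' * b + v, by ring⟩

theorem projective_quotient_span_mul_pair {a b G : R} (h : IsSMulRegular (R ⧸ span {a, G}) b)
    [Module.Projective S (R ⧸ span {a, G})] [Module.Projective S (R ⧸ span {b, G})] :
    Module.Projective S (R ⧸ span {a * b, G}) := by
  rw [span_mul_pair_eq_inf h]
  exact projective_quotient_inf_span (right_mem_span_pair a G) h

theorem span_prod_pair_eq_iInf {s : Finset ι} {a : ι → R} {G : R}
    (h : ∀ i ∈ s, ∀ j ∈ s, i ≠ j → IsSMulRegular (R ⧸ span {a i, G}) (a j)) :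
    span {∏ i ∈ s, a i, G} = ⨅ i ∈ s, span {a i, G} := by
  classical
  induction s using Finset.induction with
  | empty => simp [span_insert]
  | insert i s hi ih =>
    have hreg : IsSMulRegular (R ⧸ span {a i, G}) (∏ j ∈ s, a j) := isSMulRegular_prod fun j hj =>
      h i (s.mem_insert_self i) j (Finset.mem_insert_of_mem hj) fun hij => hi (hij ▸ hj)
    rw [Finset.prod_insert hi, span_mul_pair_eq_inf hreg, Finset.iInf_insert,
      ih fun i hi j hj => h i (Finset.mem_insert_of_mem hi) j (Finset.mem_insert_of_mem hj)]

theorem projective_quotient_span_prod_pair {s : Finset ι} {a : ι → R} {G : R}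
    (h : ∀ i ∈ s, ∀ j ∈ s, i ≠ j → IsSMulRegular (R ⧸ span {a i, G}) (a j))
    (hS : ∀ i ∈ s, Module.Projective S (R ⧸ span {a i, G})) :
    Module.Projective S (R ⧸ span {∏ i ∈ s, a i, G}) := by
  classical
  induction s using Finset.induction with
  | empty =>
    have : Subsingleton (R ⧸ span {∏ i ∈ (∅ : Finset ι), a i, G}) := by
      simp [span_insert]
    infer_instance
  | insert i s hi ih =>
    have hreg : IsSMulRegular (R ⧸ span {a i, G}) (∏ j ∈ s, a j) := isSMulRegular_prod fun j hj =>
      h i (s.mem_insert_self i) j (Finset.mem_insert_of_mem hj) fun hij => hi (hij ▸ hj)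
    have := hS i (s.mem_insert_self i)
    have := ih (fun i hi j hj => h i (Finset.mem_insert_of_mem hi) j (Finset.mem_insert_of_mem hj))
      fun i hi => hS i (Finset.mem_insert_of_mem hi)
    rw [Finset.prod_insert hi]
    exact projective_quotient_span_mul_pair hreg

theorem span_pair_prod_eq_iInf {t : Finset κ} {F : R} {b : κ → R}
    (h : ∀ i ∈ t, ∀ j ∈ t, i ≠ j → IsSMulRegular (R ⧸ span {F, b i}) (b j)) :
    span {F, ∏ i ∈ t, b i} = ⨅ i ∈ t, span {F, b i} := by
  rw [span_pair_comm, span_prod_pair_eq_iInf fun i hi j hj hne =>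
    span_pair_comm (x := F) ▸ h i hi j hj hne]
  exact biInf_congr fun i _ => span_pair_comm

theorem isSMulRegular_quotient_span_pair_prod {t : Finset κ} {F r : R} {b : κ → R}
    (h : ∀ i ∈ t, ∀ j ∈ t, i ≠ j → IsSMulRegular (R ⧸ span {F, b i}) (b j))
    (hr : ∀ i ∈ t, IsSMulRegular (R ⧸ span {F, b i}) r) :
    IsSMulRegular (R ⧸ span {F, ∏ i ∈ t, b i}) r := by
  rw [span_pair_prod_eq_iInf h]
  exact isSMulRegular_quotient_iInf fun i => isSMulRegular_quotient_iInf (hr i)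

theorem span_prod_prod_eq_iInf {s : Finset ι} {t : Finset κ} {a : ι → R} {b : κ → R}
    (ha : ∀ i ∈ s, ∀ i' ∈ s, i ≠ i' → ∀ j ∈ t, IsSMulRegular (R ⧸ span {a i, b j}) (a i'))
    (hb : ∀ i ∈ s, ∀ j ∈ t, ∀ j' ∈ t, j ≠ j' → IsSMulRegular (R ⧸ span {a i, b j}) (b j')) :
    span {∏ i ∈ s, a i, ∏ j ∈ t, b j} = ⨅ i ∈ s, ⨅ j ∈ t, span {a i, b j} := by
  rw [span_prod_pair_eq_iInf fun i hi i' hi' hne =>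
    isSMulRegular_quotient_span_pair_prod (hb i hi) (ha i hi i' hi' hne)]
  exact biInf_congr fun i hi => span_pair_prod_eq_iInf (hb i hi)

theorem projective_quotient_span_prod_prod {s : Finset ι} {t : Finset κ} {a : ι → R} {b : κ → R}
    (ha : ∀ i ∈ s, ∀ i' ∈ s, i ≠ i' → ∀ j ∈ t, IsSMulRegular (R ⧸ span {a i, b j}) (a i'))
    (hb : ∀ i ∈ s, ∀ j ∈ t, ∀ j' ∈ t, j ≠ j' → IsSMulRegular (R ⧸ span {a i, b j}) (b j'))
    (hS : ∀ i ∈ s, ∀ j ∈ t, Module.Projective S (R ⧸ span {a i, b j})) :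
    Module.Projective S (R ⧸ span {∏ i ∈ s, a i, ∏ j ∈ t, b j}) := by
  refine projective_quotient_span_prod_pair (fun i hi i' hi' hne =>
    isSMulRegular_quotient_span_pair_prod (hb i hi) (ha i hi i' hi' hne)) fun i hi => ?_
  rw [span_pair_comm]
  refine projective_quotient_span_prod_pair (fun j hj j' hj' hne => ?_) fun j hj => ?_
  · exact span_pair_comm (x := a i) ▸ hb i hi j hj j' hj' hne
  · exact span_pair_comm (x := a i) ▸ hS i hi j hj

/-- The intersection of the ideals `B t` and of the complete intersections of pairs of the
hypersurfaces `F t`, for `t` in a finite set `T`; it arises from the `B t` by iterated liaison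
addition along the `F t`. -/
def liaisonSum (F : ι → R) (B : ι → Ideal R) (T : Finset ι) : Ideal R :=
  (⨅ t ∈ T, B t) ⊓ ⨅ s ∈ T, ⨅ t ∈ T, ⨅ _ : s ≠ t, span {F s, F t}

variable {F : ι → R} {B : ι → Ideal R}

theorem mem_liaisonSum {T : Finset ι} {x : R} : x ∈ liaisonSum F B T ↔
    (∀ t ∈ T, x ∈ B t) ∧ ∀ s ∈ T, ∀ t ∈ T, s ≠ t → x ∈ span {F s, F t} := by
  simp only [liaisonSum, Submodule.mem_inf, Submodule.mem_iInf]

theorem prod_mem_liaisonSum (hFB : ∀ t, F t ∈ B t) (T : Finset ι) :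
    ∏ t ∈ T, F t ∈ liaisonSum F B T :=
  mem_liaisonSum.2 ⟨fun t ht => mem_of_dvd _ (Finset.dvd_prod_of_mem F ht) (hFB t),
    fun _ hs _ _ _ => mem_of_dvd _ (Finset.dvd_prod_of_mem F hs) (left_mem_span_pair _ _)⟩

theorem isSMulRegular_quotient_liaisonSum {T : Finset ι} {r : R}
    (hB : ∀ t ∈ T, IsSMulRegular (R ⧸ B t) r)
    (hF : ∀ s ∈ T, ∀ t ∈ T, s ≠ t → IsSMulRegular (R ⧸ span {F s, F t}) r) :
    IsSMulRegular (R ⧸ liaisonSum F B T) r :=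
  isSMulRegular_quotient_inf
    (isSMulRegular_quotient_iInf fun t => isSMulRegular_quotient_iInf (hB t))
    (isSMulRegular_quotient_iInf fun s => isSMulRegular_quotient_iInf fun hs =>
      isSMulRegular_quotient_iInf fun t => isSMulRegular_quotient_iInf fun ht =>
      isSMulRegular_quotient_iInf (hF s hs t ht))

theorem liaisonSum_insert [DecidableEq ι] {T : Finset ι} {u : ι} (hu : u ∉ T) :
    liaisonSum F B (insert u T) =
      liaisonSum F B T ⊓ B u ⊓ ⨅ s ∈ T, span {F s, F u} := by
  ext x
  simp only [mem_liaisonSum, Submodule.mem_inf, Submodule.mem_iInf, Finset.forall_mem_insert]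
  constructor
  · rintro ⟨⟨hxu, hxB⟩, -, hxT⟩
    exact ⟨⟨⟨hxB, fun s hs => (hxT s hs).2⟩, hxu⟩,
      fun s hs => (hxT s hs).1 (ne_of_mem_of_not_mem hs hu)⟩
  · rintro ⟨⟨⟨hxB, hxT⟩, hxu⟩, hxF⟩
    exact ⟨⟨hxu, hxB⟩, ⟨fun h => (h rfl).elim, fun t ht _ => span_pair_comm (x := F t) ▸ hxF t ht⟩,
      fun s hs => ⟨fun _ => hxF s hs, hxT s hs⟩⟩

theorem projective_quotient_liaisonSum (hFB : ∀ t, F t ∈ B t)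
    (hregB : ∀ s t, s ≠ t → IsSMulRegular (R ⧸ B t) (F s))
    (hregF : ∀ r s t, r ≠ s → r ≠ t → s ≠ t → IsSMulRegular (R ⧸ span {F s, F t}) (F r))
    (hB : ∀ t, Module.Projective S (R ⧸ B t))
    (hF : ∀ s t, s ≠ t → Module.Projective S (R ⧸ span {F s, F t})) (T : Finset ι) :
    Module.Projective S (R ⧸ liaisonSum F B T) := by
  classical
  induction T using Finset.induction with
  | empty =>
    have : Subsingleton (R ⧸ liaisonSum F B ∅) := by simp [liaisonSum]
    infer_instance
  | insert u T hu ih =>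
    have hne {s : ι} (hs : s ∈ T) : s ≠ u := ne_of_mem_of_not_mem hs hu
    have hreg : ∀ s ∈ T, ∀ t ∈ T, s ≠ t → IsSMulRegular (R ⧸ span {F s, F u}) (F t) :=
      fun s hs t ht hst => hregF t s u hst.symm (hne ht) (hne hs)
    have hprod : Module.Projective S (R ⧸ span {F u, ∏ t ∈ T, F t}) := by
      rw [span_pair_comm]
      exact projective_quotient_span_prod_pair hreg fun s hs => hF s u (hne hs)
    have hregu : IsSMulRegular (R ⧸ liaisonSum F B T) (F u) := isSMulRegular_quotient_liaisonSum
      (fun t ht => hregB u t (hne ht).symm)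
      fun s hs t ht => hregF u s t (hne hs).symm (hne ht).symm
    have hregT : IsSMulRegular (R ⧸ B u) (∏ t ∈ T, F t) :=
      isSMulRegular_prod fun t ht => hregB t u (hne ht)
    rw [liaisonSum_insert hu, ← span_prod_pair_eq_iInf hreg, span_pair_comm]
    exact projective_quotient_inf_inf_span (prod_mem_liaisonSum hFB T) (hFB u) hregu hregT

end Liaison

section NormallyFlat

open Ideal

/-- The ideal `p` of the `S`-algebra `R` defines a section of `Spec R → Spec S`, all of whose
infinitesimal neighbourhoods `Spec (R ⧸ p ^ n)` are projective over `S`. -/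
structure IsNormallyFlatSection (S : Type*) {R : Type*} [CommRing S] [CommRing R] [Algebra S R]
    (p : Ideal R) : Prop where
  bijective_algebraMap : Function.Bijective (algebraMap S (R ⧸ p))
  projective_quotient_pow : ∀ n, Module.Projective S (R ⧸ p ^ n)

namespace IsNormallyFlatSection

variable {S R : Type*} [CommRing S] [CommRing R] [Algebra S R] {p q : Ideal R}

theorem exists_sub_algebraMap_mem (hp : IsNormallyFlatSection S p) (x : R) :
    ∃ a : S, x - algebraMap S R a ∈ p := by
  obtain ⟨a, ha⟩ := hp.bijective_algebraMap.surjective (Ideal.Quotient.mk p x)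
  exact ⟨a, Ideal.Quotient.eq.1 ha.symm⟩

theorem algebraMap_mem_iff (hp : IsNormallyFlatSection S p) {a : S} :
    algebraMap S R a ∈ p ↔ a = 0 := by
  rw [← map_eq_zero_iff _ hp.bijective_algebraMap.injective]
  exact Ideal.Quotient.eq_zero_iff_mem.symm

theorem eq_of_le (hp : IsNormallyFlatSection S p) (hq : IsNormallyFlatSection S q) (hqp : q ≤ p) :
    q = p := by
  refine hqp.antisymm fun x hx => ?_
  obtain ⟨a, ha⟩ := hq.exists_sub_algebraMap_mem x
  have hap : algebraMap S R a ∈ p := (p.sub_mem_iff_right hx).1 (hqp ha)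
  rwa [hp.algebraMap_mem_iff.1 hap, map_zero, sub_zero] at ha

theorem isIntegral_quotient (hp : IsNormallyFlatSection S p) : Algebra.IsIntegral S (R ⧸ p) :=
  ⟨(algebraMap S (R ⧸ p)).isIntegral_of_surjective hp.bijective_algebraMap.surjective⟩

theorem map_algEquiv {R' : Type*} [CommRing R'] [Algebra S R'] (hp : IsNormallyFlatSection S p)
    (e : R ≃ₐ[S] R') : IsNormallyFlatSection S (p.map e) where
  bijective_algebraMap := by
    let e' := quotientEquivAlg p (p.map e) e rfl
    rw [← e'.toAlgHom.comp_algebraMap]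
    exact e'.bijective.comp hp.bijective_algebraMap
  projective_quotient_pow n :=
    have := hp.projective_quotient_pow n
    .of_equiv (quotientEquivAlg (p ^ n) (p.map e ^ n) e (Ideal.map_pow e p n).symm).toLinearEquiv

variable [IsDomain S]

theorem isPrime (hp : IsNormallyFlatSection S p) : p.IsPrime := by
  rw [← Quotient.isDomain_iff_prime]
  let e : S ≃+* R ⧸ p := .ofBijective (algebraMap S (R ⧸ p)) hp.bijective_algebraMap
  exact e.symm.toMulEquiv.isDomain S

/- Modulo `p` the element `e` agrees with some `a ≠ 0` of `S`, and then `e` divides `a ^ n` modulo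
`p ^ n`. -/
theorem isSMulRegular_quotient_pow (hp : IsNormallyFlatSection S p) {e : R} (he : e ∉ p) (n : ℕ) :
    IsSMulRegular (R ⧸ p ^ n) e := by
  obtain ⟨a, ha⟩ := hp.exists_sub_algebraMap_mem e
  have ha0 : a ≠ 0 := by
    rintro rfl
    rw [map_zero, sub_zero] at ha
    exact he ha
  have := hp.projective_quotient_pow n
  have hreg : IsSMulRegular (R ⧸ p ^ n) (a ^ n) :=
    Module.Flat.isSMulRegular_of_nonZeroDivisors (pow_mem (mem_nonZeroDivisors_of_ne_zero ha0) n)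
  obtain ⟨c, hc⟩ := sub_dvd_pow_sub_pow (algebraMap S R a) (algebraMap S R a - e) n
  rw [sub_sub_cancel] at hc
  have hmem : (algebraMap S R a - e) ^ n ∈ p ^ n := pow_mem_pow (sub_mem_comm_iff.1 ha) n
  rw [isSMulRegular_quotient_iff]
  intro x hx
  refine Ideal.Quotient.eq_zero_iff_mem.1 (hreg.right_eq_zero_of_smul ?_)
  have hax : algebraMap S R (a ^ n) * x ∈ p ^ n := by
    have hsplit : algebraMap S R (a ^ n) * x = c * (e * x) + (algebraMap S R a - e) ^ n * x := by
      rw [map_pow]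
      linear_combination x * hc
    rw [hsplit]
    exact add_mem (mul_mem_left _ c hx) (mul_mem_right x _ hmem)
  rw [Algebra.smul_def]
  exact Ideal.Quotient.eq_zero_iff_mem.2 hax

end IsNormallyFlatSection

theorem isIntegral_quotient_iff {S R : Type*} [CommRing S] [CommRing R] [Algebra S R]
    {I : Ideal R} : Algebra.IsIntegral S (R ⧸ I) ↔
      ∀ x : R, ∃ f : Polynomial S, f.Monic ∧ f.aeval x ∈ I := by
  rw [Algebra.isIntegral_def, Ideal.Quotient.mk_surjective.forall]
  refine forall_congr' fun x => exists_congr fun f => and_congr_right fun _ => ?_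
  rw [← Quotient.mkₐ_eq_mk S, ← Polynomial.aeval_def, Polynomial.aeval_algHom_apply,
    Quotient.mkₐ_eq_mk, Ideal.Quotient.eq_zero_iff_mem]

theorem isIntegral_quotient_biInf_pow {S R : Type*} [CommRing S] [CommRing R] [Algebra S R]
    {P : Set (Ideal R)} (hP : P.Finite) (h : ∀ p ∈ P, Algebra.IsIntegral S (R ⧸ p))
    (b : Ideal R → ℕ) : Algebra.IsIntegral S (R ⧸ ⨅ p ∈ P, p ^ b p) := by
  simp only [isIntegral_quotient_iff] at *
  intro x
  choose! f hf hfx using fun p hp => h p hp x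
  refine ⟨∏ p ∈ hP.toFinset, f p ^ b p, ?_, ?_⟩
  · exact Polynomial.monic_prod_of_monic _ _ fun p hp => (hf p (hP.mem_toFinset.1 hp)).pow _
  · simp only [map_prod, map_pow, Submodule.mem_iInf]
    exact fun p hp => mem_of_dvd _ (Finset.dvd_prod_of_mem _ (hP.mem_toFinset.2 hp))
      (pow_mem_pow (hfx p hp) _)

section IdealOfVars

open MvPolynomial

variable (ι S : Type*) [CommRing S]

theorem free_quotient_pow_idealOfVars (n : ℕ) :
    Module.Free S (MvPolynomial ι S ⧸ idealOfVars ι S ^ n) := by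
  let f : MvPolynomial ι S →ₗ[S] ({μ : ι →₀ ℕ | μ.degree < n} →₀ S) :=
    Finsupp.lsubtypeDomain _ ∘ₗ (AddMonoidAlgebra.coeffLinearEquiv S).toLinearMap
  have f_apply (x : MvPolynomial ι S) (μ) : f x μ = x.coeff μ := rfl
  have hker : LinearMap.ker f = (idealOfVars ι S ^ n).restrictScalars S := by
    ext x
    simp [Finsupp.ext_iff, mem_pow_idealOfVars_iff', f_apply]
  have hf : Function.Surjective f := fun g => by
    obtain ⟨x, hx⟩ := (AddMonoidAlgebra.coeffLinearEquiv S).surjective g.extendDomain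
    exact ⟨x, (congrArg _ hx).trans (Finsupp.subtypeDomain_extendDomain g)⟩
  have e := (Submodule.quotEquivOfEq _ _ hker).symm.trans (f.quotKerEquivOfSurjective hf)
  exact .of_equiv e.symm

theorem isNormallyFlatSection_idealOfVars : IsNormallyFlatSection S (idealOfVars ι S) where
  bijective_algebraMap := by
    have hmem (x : MvPolynomial ι S) : x ∈ idealOfVars ι S ↔ x.coeff 0 = 0 := by
      simpa [Finsupp.degree_eq_zero_iff] using mem_pow_idealOfVars_iff' 1 x
    refine ⟨(injective_iff_map_eq_zero _).2 fun a ha => ?_, fun x => ?_⟩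
    · simpa [hmem] using Ideal.Quotient.eq_zero_iff_mem.1 ha
    · obtain ⟨x, rfl⟩ := Ideal.Quotient.mk_surjective x
      exact ⟨x.coeff 0, Ideal.Quotient.eq.2 ((hmem _).2 (by simp))⟩
  projective_quotient_pow n :=
    have := free_quotient_pow_idealOfVars ι S n
    inferInstance

end IdealOfVars

end NormallyFlat

section Colouring

open Ideal

variable {S R ι κ : Type*} [CommRing S] [CommRing R] [Algebra S R]

/-- The product of the `L i` of colour `t` in the colouring `c`; these products are the
hypersurfaces along which liaison addition is iterated. -/
def colourProd [Fintype κ] [DecidableEq ι] (L : κ → R) (c : κ → ι) (t : ι) : R :=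
  ∏ i with c i = t, L i

section ColourProd

variable [Fintype κ] [DecidableEq ι] {L : κ → R} {c : κ → ι} {r s t : ι}

theorem span_colourProd_pair_eq_iInf
    (hreg : ∀ i j m, c i ≠ c j → m ≠ i → m ≠ j → IsSMulRegular (R ⧸ span {L i, L j}) (L m))
    (hst : s ≠ t) : span {colourProd L c s, colourProd L c t} =
      ⨅ i, ⨅ _ : c i = s, ⨅ j, ⨅ _ : c j = t, span {L i, L j} := by
  refine (span_prod_prod_eq_iInf ?_ ?_).trans (by simp only [Finset.mem_filter_univ])
  all_goals simp only [Finset.mem_filter_univ]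
  · rintro i rfl i' hi' hne j rfl
    exact hreg i j i' hst hne.symm fun h => hst (h ▸ hi').symm
  · rintro i rfl j rfl j' hj' hne
    exact hreg i j j' hst (fun h => hst (h ▸ hj')) hne.symm

theorem projective_quotient_span_colourProd_pair
    (hreg : ∀ i j m, c i ≠ c j → m ≠ i → m ≠ j → IsSMulRegular (R ⧸ span {L i, L j}) (L m))
    (hL : ∀ i j, c i ≠ c j → Module.Projective S (R ⧸ span {L i, L j})) (hst : s ≠ t) :
    Module.Projective S (R ⧸ span {colourProd L c s, colourProd L c t}) := by
  refine projective_quotient_span_prod_prod ?_ ?_ ?_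
  all_goals simp only [Finset.mem_filter_univ]
  · rintro i rfl i' hi' hne j rfl
    exact hreg i j i' hst hne.symm fun h => hst (h ▸ hi').symm
  · rintro i rfl j rfl j' hj' hne
    exact hreg i j j' hst (fun h => hst (h ▸ hj')) hne.symm
  · rintro i rfl j rfl
    exact hL i j hst

theorem isSMulRegular_quotient_span_colourProd_pair
    (hreg : ∀ i j m, c i ≠ c j → m ≠ i → m ≠ j → IsSMulRegular (R ⧸ span {L i, L j}) (L m))
    (hrs : r ≠ s) (hrt : r ≠ t) (hst : s ≠ t) :
    IsSMulRegular (R ⧸ span {colourProd L c s, colourProd L c t}) (colourProd L c r) := by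
  refine isSMulRegular_prod fun m hm => ?_
  rw [span_colourProd_pair_eq_iInf hreg hst]
  refine isSMulRegular_quotient_iInf fun i => isSMulRegular_quotient_iInf fun hi =>
    isSMulRegular_quotient_iInf fun j => isSMulRegular_quotient_iInf fun hj => ?_
  rw [Finset.mem_filter_univ] at hm
  subst hm hi hj
  exact hreg i j m hst (fun h => hrs (h ▸ rfl)) fun h => hrt (h ▸ rfl)

theorem liaisonSum_colourProd [Fintype ι] {B : ι → Ideal R}
    (hreg : ∀ i j m, c i ≠ c j → m ≠ i → m ≠ j → IsSMulRegular (R ⧸ span {L i, L j}) (L m)) :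
    liaisonSum (colourProd L c) B Finset.univ =
      (⨅ t, B t) ⊓ ⨅ i, ⨅ j, ⨅ _ : c i ≠ c j, span {L i, L j} := by
  ext x
  have mem_span {s t : ι} (hst : s ≠ t) : x ∈ span {colourProd L c s, colourProd L c t} ↔
      ∀ i, c i = s → ∀ j, c j = t → x ∈ span {L i, L j} := by
    simp only [span_colourProd_pair_eq_iInf hreg hst, Submodule.mem_iInf]
  simp only [mem_liaisonSum, Submodule.mem_inf, Submodule.mem_iInf, Finset.mem_univ, true_imp_iff]
  refine and_congr_right fun _ => ⟨fun h i j hij => (mem_span hij).1 (h _ _ hij) i rfl j rfl,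
    fun h s t hst => (mem_span hst).2 ?_⟩
  rintro i rfl j rfl
  exact h i j hst

theorem projective_quotient_inf_iInf_span_pair [Finite ι] {B : ι → Ideal R}
    (hreg : ∀ i j m, c i ≠ c j → m ≠ i → m ≠ j → IsSMulRegular (R ⧸ span {L i, L j}) (L m))
    (hL : ∀ i j, c i ≠ c j → Module.Projective S (R ⧸ span {L i, L j}))
    (hprod : ∀ t, colourProd L c t ∈ B t)
    (hregB : ∀ i t, c i ≠ t → IsSMulRegular (R ⧸ B t) (L i))
    (hB : ∀ t, Module.Projective S (R ⧸ B t)) :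
    Module.Projective S
      (R ⧸ (⨅ t, B t) ⊓ ⨅ i, ⨅ j, ⨅ _ : c i ≠ c j, span {L i, L j}) := by
  cases nonempty_fintype ι
  rw [← liaisonSum_colourProd hreg]
  exact projective_quotient_liaisonSum hprod
    (fun s t hst => isSMulRegular_prod fun i hi =>
      hregB i t ((Finset.mem_filter_univ i).1 hi ▸ hst))
    (fun _ _ _ => isSMulRegular_quotient_span_colourProd_pair hreg) hB
    (fun _ _ => projective_quotient_span_colourProd_pair hreg hL) _

end ColourProd

/-- The ideals of the pairwise intersections of the hypersurfaces `L i = 0`. -/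
def pairIdeals (L : κ → R) : Set (Ideal R) :=
  {p | ∃ i j, i ≠ j ∧ p = span {L i, L j}}

/-- The number of the hypersurfaces `L i = 0` that contain the zero locus of `p`. -/
noncomputable def incidenceNumber (L : κ → R) (p : Ideal R) : ℕ :=
  {i | L i ∈ p}.ncard

variable {L : κ → R} {p : Ideal R} {i j m : κ}

theorem span_pair_mem_pairIdeals (hij : i ≠ j) : span {L i, L j} ∈ pairIdeals L :=
  ⟨i, j, hij, rfl⟩

theorem prod_mem_pow_incidenceNumber {s : Finset κ} (hs : ∀ i, i ∈ s ↔ L i ∈ p) :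
    ∏ i ∈ s, L i ∈ p ^ incidenceNumber L p := by
  have hcard : incidenceNumber L p = s.card := by
    rw [incidenceNumber, ← Set.ncard_coe_finset]
    exact congrArg Set.ncard (Set.ext fun i => (hs i).symm)
  rw [hcard, ← Finset.prod_const]
  exact prod_mem_prod fun i hi => (hs i).1 hi

/-- The ideals of the intersections that lie on at least three of the hypersurfaces `L i = 0`. -/
def multiplePairIdeals (L : κ → R) : Set (Ideal R) :=
  {p ∈ pairIdeals L | 3 ≤ incidenceNumber L p}

theorem eq_span_pair_of_mem (hL : ∀ p ∈ pairIdeals L, IsNormallyFlatSection S p)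
    (hp : p ∈ pairIdeals L) (hij : i ≠ j) (hi : L i ∈ p) (hj : L j ∈ p) : span {L i, L j} = p :=
  (hL p hp).eq_of_le (hL _ (span_pair_mem_pairIdeals hij)) (span_pair_le_iff.2 ⟨hi, hj⟩)

theorem exists_colouring (L : κ → R) {P : Set (Ideal R)}
    (hP : ∀ i, ∀ p ∈ P, ∀ q ∈ P, L i ∈ p → L i ∈ q → p = q) :
    ∃ c : κ → P ⊕ κ, (∀ i p, c i = .inl p ↔ L i ∈ p.1) ∧ ∀ i j, c i = .inr j → i = j := by
  classical
  refine ⟨fun i => if h : ∃ p : P, L i ∈ p.1 then .inl h.choose else .inr i, ?_, ?_⟩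
  · intro i p
    dsimp only
    split_ifs with h
    · rw [Sum.inl.injEq]
      exact ⟨fun hp => hp ▸ h.choose_spec,
        fun hp => Subtype.ext (hP i _ h.choose.2 _ p.2 h.choose_spec hp)⟩
    · exact ⟨nofun, fun hp => (h ⟨p, hp⟩).elim⟩
  · intro i j hij
    dsimp only at hij
    split_ifs at hij
    exact Sum.inr.inj hij

theorem finite_pairIdeals [Finite κ] (L : κ → R) : (pairIdeals L).Finite := by
  refine (Set.finite_range fun x : κ × κ => span {L x.1, L x.2}).subset ?_
  rintro _ ⟨i, j, -, rfl⟩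
  exact ⟨(i, j), rfl⟩

theorem two_le_incidenceNumber [Finite κ] (hp : p ∈ pairIdeals L) : 2 ≤ incidenceNumber L p := by
  obtain ⟨i, j, hij, rfl⟩ := hp
  exact (Set.one_lt_ncard_iff (Set.toFinite _)).2
    ⟨i, j, left_mem_span_pair _ _, right_mem_span_pair _ _, hij⟩

theorem three_le_incidenceNumber_span_pair [Finite κ] (hij : i ≠ j) (hmi : m ≠ i) (hmj : m ≠ j)
    (hm : L m ∈ span {L i, L j}) : 3 ≤ incidenceNumber L (span {L i, L j}) :=
  (Set.two_lt_ncard_iff (Set.toFinite _)).2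
    ⟨m, i, j, hm, left_mem_span_pair _ _, right_mem_span_pair _ _, hmi, hmj, hij⟩

theorem colour_eq_iff (hL : ∀ p ∈ pairIdeals L, IsNormallyFlatSection S p)
    {c : κ → multiplePairIdeals L ⊕ κ} (hc : ∀ i p, c i = .inl p ↔ L i ∈ p.1)
    (hc' : ∀ i j, c i = .inr j → i = j) (hij : i ≠ j) :
    c i = c j ↔ 3 ≤ incidenceNumber L (span {L i, L j}) := by
  constructor
  · intro h
    rcases hci : c i with p | m
    · rw [eq_span_pair_of_mem hL p.2.1 hij ((hc i p).1 hci) ((hc j p).1 (h ▸ hci))]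
      exact p.2.2
    · exact (hij ((hc' i m hci).trans (hc' j m (h ▸ hci)).symm)).elim
  · intro h
    let p : multiplePairIdeals L := ⟨span {L i, L j}, span_pair_mem_pairIdeals hij, h⟩
    exact ((hc i p).2 (left_mem_span_pair _ _)).trans ((hc j p).2 (right_mem_span_pair _ _)).symm

theorem iInf_pow_pairIdeals_eq [Finite κ] (hL : ∀ p ∈ pairIdeals L, IsNormallyFlatSection S p)
    {b : Ideal R → ℕ} (hb : ∀ p ∈ pairIdeals L, incidenceNumber L p = 2 → b p = 1)
    {c : κ → multiplePairIdeals L ⊕ κ} (hc : ∀ i p, c i = .inl p ↔ L i ∈ p.1)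
    (hc' : ∀ i j, c i = .inr j → i = j) :
    ⨅ p ∈ pairIdeals L, p ^ b p =
      (⨅ p : multiplePairIdeals L, p.1 ^ b p) ⊓ ⨅ i, ⨅ j, ⨅ _ : c i ≠ c j, span {L i, L j} := by
  have hsimple {i j : κ} (hij : i ≠ j) (h : c i ≠ c j) : b (span {L i, L j}) = 1 := by
    rw [ne_eq, colour_eq_iff hL hc hc' hij, not_le] at h
    have hmem : span {L i, L j} ∈ pairIdeals L := span_pair_mem_pairIdeals hij
    exact hb _ hmem (Nat.le_antisymm (Nat.le_of_lt_succ h) (two_le_incidenceNumber hmem))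
  refine le_antisymm (le_inf ?_ ?_) ?_
  · exact le_iInf fun p => iInf₂_le p.1 p.2.1
  · refine le_iInf fun i => le_iInf fun j => le_iInf fun h => ?_
    have hij : i ≠ j := fun hij => h (congrArg c hij)
    exact (iInf₂_le _ (span_pair_mem_pairIdeals hij)).trans_eq (by rw [hsimple hij h, pow_one])
  · refine le_iInf₂ fun p hp => ?_
    by_cases h : 3 ≤ incidenceNumber L p
    · exact inf_le_of_left_le (iInf_le (fun p : multiplePairIdeals L => p.1 ^ b p) ⟨p, hp, h⟩)
    · obtain ⟨i, j, hij, rfl⟩ := hp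
      rw [← colour_eq_iff hL hc hc' hij] at h
      rw [hsimple hij h, pow_one]
      exact inf_le_of_right_le (iInf_le_of_le i (iInf_le_of_le j (iInf_le _ h)))

theorem projective_quotient_iInf_pow_pairIdeals [IsDomain S] [Finite κ]
    (hL : ∀ p ∈ pairIdeals L, IsNormallyFlatSection S p) {b : Ideal R → ℕ}
    (hb_two : ∀ p ∈ pairIdeals L, incidenceNumber L p = 2 → b p = 1)
    (hb_other : ∀ p ∈ pairIdeals L, incidenceNumber L p ≠ 2 → b p ≤ incidenceNumber L p)
    (hfactor : ∀ i, ∀ p ∈ multiplePairIdeals L, ∀ q ∈ multiplePairIdeals L,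
      L i ∈ p → L i ∈ q → p = q) :
    Module.Projective S (R ⧸ ⨅ p ∈ pairIdeals L, p ^ b p) := by
  classical
  let := Fintype.ofFinite κ
  have : Finite (multiplePairIdeals L) := (finite_pairIdeals L).subset (Set.sep_subset _ _)
  let := Fintype.ofFinite (multiplePairIdeals L)
  obtain ⟨c, hc, hc'⟩ := exists_colouring L hfactor
  let B : multiplePairIdeals L ⊕ κ → Ideal R := Sum.elim (fun p => p.1 ^ b p) fun _ => ⊤
  have hBinf : ⨅ p : multiplePairIdeals L, p.1 ^ b p = ⨅ t, B t := by simp [B, iInf_sum]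
  have hne {i j : κ} (h : c i ≠ c j) : i ≠ j := fun hij => h (congrArg c hij)
  have hsec {i j : κ} (h : c i ≠ c j) : IsNormallyFlatSection S (span {L i, L j}) :=
    hL _ (span_pair_mem_pairIdeals (hne h))
  rw [iInf_pow_pairIdeals_eq hL hb_two hc hc', hBinf]
  refine projective_quotient_inf_iInf_span_pair ?_ ?_ ?_ ?_ ?_
  · intro i j m h hmi hmj
    have hm : L m ∉ span {L i, L j} := fun hm => h <| (colour_eq_iff hL hc hc' (hne h)).2
      (three_le_incidenceNumber_span_pair (hne h) hmi hmj hm)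
    exact pow_one (span {L i, L j}) ▸ (hsec h).isSMulRegular_quotient_pow hm 1
  · intro i j h
    exact pow_one (span {L i, L j}) ▸ (hsec h).projective_quotient_pow 1
  · rintro (p | _)
    · refine pow_le_pow_right (hb_other p p.2.1 ?_) (prod_mem_pow_incidenceNumber fun i => ?_)
      · exact (Nat.lt_of_lt_of_le (by decide) p.2.2).ne'
      · simp [hc]
    · trivial
  · rintro i (p | _) h
    · exact (hL p p.2.1).isSMulRegular_quotient_pow (fun hi => h ((hc i p).2 hi)) _
    · exact Function.injective_of_subsingleton (α := R ⧸ (⊤ : Ideal R)) _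
  · rintro (p | _)
    · exact (hL p p.2.1).projective_quotient_pow _
    · exact inferInstanceAs (Module.Projective S (R ⧸ (⊤ : Ideal R)))

end Colouring

theorem exists_forall_sup_span_range_eq_top {K V ι : Type*} [Field K] [Infinite K] [AddCommGroup V]
    [Module K V] [FiniteDimensional K V] [Finite ι] (W : ι → Submodule K V) {m : ℕ}
    (hW : ∀ i, Module.finrank K V ≤ Module.finrank K (W i) + m) :
    ∃ y : Fin m → V, ∀ i, W i ⊔ Submodule.span K (Set.range y) = ⊤ := by
  induction m generalizing W with
  | zero => exact ⟨Fin.elim0, fun i => by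
      rw [Submodule.eq_top_of_finrank_eq ((W i).finrank_le.antisymm (hW i)), top_sup_eq]⟩
  | succ m ih =>
    obtain ⟨v, hv⟩ : ∃ v, ∀ i, W i ≠ ⊤ → v ∉ W i := by
      by_contra! h
      obtain ⟨i, hi⟩ := Subspace.exists_eq_top_of_iUnion_eq_univ
        (p := fun i : {i // W i ≠ ⊤} => W i) <| Set.iUnion_eq_univ_iff.2 fun v =>
          let ⟨i, hi, hv⟩ := h v; ⟨⟨i, hi⟩, hv⟩
      exact i.2 hi
    obtain ⟨y, hy⟩ := ih (fun i => W i ⊔ Submodule.span K {v}) fun i => by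
      by_cases hi : W i = ⊤
      · rw [hi, top_sup_eq, finrank_top]
        exact Nat.le_add_right _ _
      · have hlt : W i < W i ⊔ Submodule.span K {v} := left_lt_sup.2 fun h =>
          hv i hi ((Submodule.span_singleton_le_iff_mem _ _).1 h)
        have := Submodule.finrank_lt_finrank_of_lt hlt
        have := hW i
        omega
    refine ⟨Fin.cons v y, fun i => ?_⟩
    rw [Fin.range_cons, Submodule.span_insert, ← sup_assoc, hy]

section GeneralForms

open MvPolynomial

variable {σ τ υ ι k : Type*}

theorem finrank_homogeneousSubmodule_one [Fintype σ] [Field k] :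
    Module.finrank k (homogeneousSubmodule σ k 1) = Fintype.card σ := by
  rw [homogeneousSubmodule_one_eq_span_X, finrank_span_eq_card (linearIndependent_X σ k)]

theorem card_le_of_linearIndependent_of_isHomogeneous_one [Fintype σ] [Fintype τ] [Field k]
    {u : τ → MvPolynomial σ k} (hu : ∀ j, (u j).IsHomogeneous 1) (hli : LinearIndependent k u) :
    Fintype.card τ ≤ Fintype.card σ := by
  classical
  refine (linearIndependent_le_span_aux' u hli (Set.range X) ?_).trans (Fintype.card_range_le X)
  rw [← homogeneousSubmodule_one_eq_span_X]
  exact Set.range_subset_iff.2 hu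

theorem exists_forall_homogeneousSubmodule_one_le_span [Fintype σ] [Fintype τ] [Finite ι] [Field k]
    [Infinite k] {u : ι → τ → MvPolynomial σ k} (hu : ∀ i j, (u i j).IsHomogeneous 1)
    (hli : ∀ i, LinearIndependent k (u i)) {m : ℕ} (hm : Fintype.card σ ≤ Fintype.card τ + m) :
    ∃ y : Fin m → MvPolynomial σ k, ∀ i,
      homogeneousSubmodule σ k 1 ≤ Submodule.span k (Set.range (Sum.elim (u i) y)) := by
  have : FiniteDimensional k (homogeneousSubmodule σ k 1) := by
    rw [homogeneousSubmodule_one_eq_span_X]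
    exact .span_of_finite k (Set.finite_range X)
  let v (i : ι) (j : τ) : homogeneousSubmodule σ k 1 := ⟨u i j, hu i j⟩
  have hv (i : ι) : LinearIndependent k (v i) :=
    .of_comp (homogeneousSubmodule σ k 1).subtype (hli i)
  obtain ⟨y, hy⟩ := exists_forall_sup_span_range_eq_top
    (fun i => Submodule.span k (Set.range (v i))) (m := m) fun i => by
      rwa [finrank_homogeneousSubmodule_one, finrank_span_eq_card (hv i)]
  refine ⟨fun j => y j, fun i => ?_⟩
  have hspan := congrArg (Submodule.map (homogeneousSubmodule σ k 1).subtype) (hy i)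
  rw [Submodule.map_top, Submodule.range_subtype, ← Submodule.span_union, Submodule.map_span,
    Set.image_union, ← Set.range_comp, ← Set.range_comp] at hspan
  rw [Set.Sum.elim_range]
  exact hspan.ge

theorem bijective_aeval_of_homogeneousSubmodule_one_le_span [Fintype σ] [Fintype τ] [Field k]
    {v : τ → MvPolynomial σ k} (hcard : Fintype.card τ = Fintype.card σ)
    (hv : homogeneousSubmodule σ k 1 ≤ Submodule.span k (Set.range v)) :
    Function.Bijective (aeval v : MvPolynomial τ k →ₐ[k] MvPolynomial σ k) := by
  have hadjoin : Algebra.adjoin k (Set.range v) = ⊤ := by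
    rw [eq_top_iff, ← adjoin_range_X, Algebra.adjoin_le_iff]
    rintro _ ⟨i, rfl⟩
    exact Algebra.span_le_adjoin k _ (hv (isHomogeneous_X k i))
  have : Algebra.IsAlgebraic (Algebra.adjoin k (Set.range v)) (MvPolynomial σ k) :=
    ⟨fun x => isAlgebraic_algebraMap
      (⟨x, hadjoin ▸ Algebra.mem_top⟩ : Algebra.adjoin k (Set.range v))⟩
  have hbasis : IsTranscendenceBasis k v :=
    Algebra.IsAlgebraic.isTranscendenceBasis_of_lift_le_trdeg_of_finite k v (by simp [hcard])
  refine ⟨hbasis.1, ?_⟩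
  rwa [← AlgHom.range_eq_top, ← Algebra.adjoin_range_eq_range_aeval]

theorem bijective_aeval_of_bijective_aeval_sumElim {A : Type*} [CommRing k] [CommRing A]
    [Algebra k A] [Algebra (MvPolynomial υ k) A] [IsScalarTower k (MvPolynomial υ k) A] {u : τ → A}
    (h : Function.Bijective (aeval (Sum.elim u fun j => algebraMap (MvPolynomial υ k) A (X j)) :
      MvPolynomial (τ ⊕ υ) k →ₐ[k] A)) :
    Function.Bijective (aeval u : MvPolynomial τ (MvPolynomial υ k) →ₐ[MvPolynomial υ k] A) := by
  have hcomp : aeval (Sum.elim u fun j => algebraMap (MvPolynomial υ k) A (X j)) =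
      ((aeval u : MvPolynomial τ (MvPolynomial υ k) →ₐ[MvPolynomial υ k] A).restrictScalars k).comp
        (sumAlgEquiv k τ υ).toAlgHom := by
    ext (i | j) <;> simp
  rw [hcomp] at h
  exact ((sumAlgEquiv k τ υ).bijective.of_comp_iff _).1 h

theorem isNormallyFlatSection_span_range {S R : Type*} [CommRing S] [CommRing R] [Algebra S R]
    {u : τ → R} (hu : Function.Bijective (aeval u : MvPolynomial τ S →ₐ[S] R)) :
    IsNormallyFlatSection S (Ideal.span (Set.range u)) := by
  have h := (isNormallyFlatSection_idealOfVars τ S).map_algEquiv (.ofBijective (aeval u) hu)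
  rw [idealOfVars, Ideal.map_span, ← Set.range_comp] at h
  convert h
  ext i
  simp

theorem isNormallyFlatSection_span_range_of_homogeneousSubmodule_one_le_span [Fintype σ] [Fintype τ]
    [Fintype υ] [Field k] [Algebra (MvPolynomial υ k) (MvPolynomial σ k)]
    [IsScalarTower k (MvPolynomial υ k) (MvPolynomial σ k)] {u : τ → MvPolynomial σ k}
    (hcard : Fintype.card τ + Fintype.card υ = Fintype.card σ)
    (hu : homogeneousSubmodule σ k 1 ≤ Submodule.span k (Set.range
      (Sum.elim u fun j => algebraMap (MvPolynomial υ k) (MvPolynomial σ k) (X j)))) :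
    IsNormallyFlatSection (MvPolynomial υ k) (Ideal.span (Set.range u)) :=
  isNormallyFlatSection_span_range <| bijective_aeval_of_bijective_aeval_sumElim <|
    bijective_aeval_of_homogeneousSubmodule_one_le_span (by rwa [Fintype.card_sum]) hu

end GeneralForms

section Jacobian

open MvPolynomial

variable {σ κ k : Type*}

/-- The Jacobian ideal of a polynomial in arbitrarily many variables, generated by its partial
derivatives. -/
noncomputable def gradientIdeal [CommRing k] (f : MvPolynomial σ k) : Ideal (MvPolynomial σ k) :=
  Ideal.span (Set.range fun j => pderiv j f)

theorem gradientIdeal_le_iff [CommRing k] {f : MvPolynomial σ k} {q : Ideal (MvPolynomial σ k)} :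
    gradientIdeal f ≤ q ↔ ∀ j, pderiv j f ∈ q :=
  Ideal.span_le.trans Set.range_subset_iff

theorem gradientIdeal_mul_le [CommRing k] {f g : MvPolynomial σ k} {q : Ideal (MvPolynomial σ k)}
    (hf : f ∈ q) (hg : g ∈ q) : gradientIdeal (f * g) ≤ q := by
  rw [gradientIdeal_le_iff]
  intro j
  rw [Derivation.leibniz]
  exact q.add_mem (q.mul_mem_right _ hf) (q.mul_mem_right _ hg)

theorem mem_gradientIdeal_of_isHomogeneous [Finite σ] [Field k] {f : MvPolynomial σ k} {n : ℕ}
    (hf : f.IsHomogeneous n) (hn : (n : k) ≠ 0) : f ∈ gradientIdeal f := by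
  cases nonempty_fintype σ
  have hsum : ∑ i, X i * pderiv i f ∈ gradientIdeal f :=
    sum_mem fun i _ => Ideal.mul_mem_left _ _ (gradientIdeal_le_iff.1 le_rfl i)
  rw [hf.sum_X_mul_pderiv, nsmul_eq_mul, ← map_natCast C] at hsum
  exact (Ideal.unit_mul_mem_iff_mem _ ((isUnit_iff_ne_zero.2 hn).map C)).1 hsum

theorem exists_isUnit_pderiv_of_isHomogeneous_one [Finite σ] [Field k] {f : MvPolynomial σ k}
    (hf : f.IsHomogeneous 1) (hf0 : f ≠ 0) : ∃ j, IsUnit (pderiv j f) := by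
  cases nonempty_fintype σ
  have heuler := hf.sum_X_mul_pderiv
  rw [one_nsmul] at heuler
  obtain ⟨j, -, hj⟩ := Finset.exists_ne_zero_of_sum_ne_zero (heuler ▸ hf0)
  have hC : pderiv j f = C (coeff 0 (pderiv j f)) :=
    totalDegree_eq_zero_iff_eq_C.1 ((totalDegree_zero_iff_isHomogeneous σ).2 hf.pderiv)
  refine ⟨j, hC ▸ (isUnit_iff_ne_zero.2 fun h0 => hj ?_).map C⟩
  rw [hC, h0, C_0, mul_zero]

theorem exists_pair_mem_of_gradientIdeal_prod_le [Finite σ] [Fintype κ] [Field k]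
    {L : κ → MvPolynomial σ k} (hL : ∀ i, (L i).IsHomogeneous 1) (hL0 : ∀ i, L i ≠ 0)
    (hκ : (Fintype.card κ : k) ≠ 0) {q : Ideal (MvPolynomial σ k)} (hq : q.IsPrime)
    (h : gradientIdeal (∏ i, L i) ≤ q) : ∃ i j, i ≠ j ∧ L i ∈ q ∧ L j ∈ q := by
  classical
  have hhom : (∏ i, L i).IsHomogeneous (Fintype.card κ) := by
    simpa using IsHomogeneous.prod Finset.univ L (fun _ => 1) fun i _ => hL i
  obtain ⟨i, -, hi⟩ := hq.prod_mem_iff.1 (h (mem_gradientIdeal_of_isHomogeneous hhom hκ))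
  obtain ⟨l, hl⟩ := exists_isUnit_pderiv_of_isHomogeneous_one (hL i) (hL0 i)
  have hder := gradientIdeal_le_iff.1 h l
  rw [← Finset.mul_prod_erase _ _ (Finset.mem_univ i), Derivation.leibniz, smul_eq_mul, smul_eq_mul,
    q.add_mem_iff_right (q.mul_mem_right _ hi), Ideal.mul_unit_mem_iff_mem _ hl] at hder
  obtain ⟨j, hj, hjq⟩ := hq.prod_mem_iff.1 hder
  exact ⟨i, j, (Finset.ne_of_mem_erase hj).symm, hi, hjq⟩

theorem minimalPrimes_gradientIdeal_prod [Finite σ] [Fintype κ] [Field k]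
    {L : κ → MvPolynomial σ k} (hL : ∀ i, (L i).IsHomogeneous 1) (hL0 : ∀ i, L i ≠ 0)
    (hκ : (Fintype.card κ : k) ≠ 0) (hprime : ∀ p ∈ pairIdeals L, p.IsPrime)
    (hanti : IsAntichain (· ≤ ·) (pairIdeals L)) :
    (gradientIdeal (∏ i, L i)).minimalPrimes = pairIdeals L := by
  classical
  have hle {p : Ideal (MvPolynomial σ k)} (hp : p ∈ pairIdeals L) :
      gradientIdeal (∏ i, L i) ≤ p := by
    obtain ⟨i, j, hij, rfl⟩ := hp
    rw [← Finset.mul_prod_erase _ _ (Finset.mem_univ i)]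
    exact gradientIdeal_mul_le (left_mem_span_pair _ _) <| Ideal.mem_of_dvd _
      (Finset.dvd_prod_of_mem _ (by simp [hij.symm])) (right_mem_span_pair (L i) (L j))
  have hge {q : Ideal (MvPolynomial σ k)} (hq : q.IsPrime) (h : gradientIdeal (∏ i, L i) ≤ q) :
      ∃ p ∈ pairIdeals L, p ≤ q := by
    obtain ⟨i, j, hij, hi, hj⟩ := exists_pair_mem_of_gradientIdeal_prod_le hL hL0 hκ hq h
    exact ⟨_, span_pair_mem_pairIdeals hij, span_pair_le_iff.2 ⟨hi, hj⟩⟩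
  ext p
  constructor
  · rintro ⟨⟨hp, hJp⟩, hmin⟩
    obtain ⟨q, hq, hqp⟩ := hge hp hJp
    exact hqp.antisymm (hmin ⟨hprime q hq, hle hq⟩ hqp) ▸ hq
  · refine fun hp => ⟨⟨hprime p hp, hle hp⟩, fun q ⟨hq, hJq⟩ hqp => ?_⟩
    obtain ⟨p', hp', hp'q⟩ := hge hq hJq
    exact (hanti.eq hp' hp (hp'q.trans hqp)).ge.trans hp'q

end Jacobian

section General

open MvPolynomial

variable {σ κ k : Type*} [Finite σ] [Finite κ] [Field k]

theorem exists_algebra_isNormallyFlatSection [Infinite k] {L : κ → MvPolynomial σ k}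
    (hL : ∀ i, (L i).IsHomogeneous 1) (hli : ∀ i j, i ≠ j → LinearIndependent k ![L i, L j]) :
    ∃ (m : ℕ) (_ : Algebra (MvPolynomial (Fin m) k) (MvPolynomial σ k)),
      ∀ p ∈ pairIdeals L, IsNormallyFlatSection (MvPolynomial (Fin m) k) p := by
  cases nonempty_fintype σ
  obtain ⟨m, hm, hcard⟩ : ∃ m, Fintype.card σ ≤ 2 + m ∧
      ∀ i j : κ, i ≠ j → 2 + m = Fintype.card σ :=
    ⟨Fintype.card σ - 2, le_add_tsub, fun i j hij => add_tsub_cancel_of_le <| by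
      simpa using card_le_of_linearIndependent_of_isHomogeneous_one
        (Fin.forall_fin_two.2 ⟨hL i, hL j⟩) (hli i j hij)⟩
  obtain ⟨y, hy⟩ := exists_forall_homogeneousSubmodule_one_le_span
    (ι := {x : κ × κ // x.1 ≠ x.2}) (u := fun x => ![L x.1.1, L x.1.2]) (m := m)
    (fun x => Fin.forall_fin_two.2 ⟨hL _, hL _⟩) (fun x => hli _ _ x.2) (by simpa using hm)
  let algebra : Algebra (MvPolynomial (Fin m) k) (MvPolynomial σ k) :=
    (aeval y).toRingHom.toAlgebra
  have : IsScalarTower k (MvPolynomial (Fin m) k) (MvPolynomial σ k) :=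
    .of_algebraMap_eq' (aeval y).comp_algebraMap.symm
  have hX : (fun j => algebraMap (MvPolynomial (Fin m) k) (MvPolynomial σ k) (X j)) = y :=
    funext fun j => by rw [RingHom.algebraMap_toAlgebra]; exact aeval_X y j
  refine ⟨m, algebra, ?_⟩
  rintro _ ⟨i, j, hij, rfl⟩
  rw [← Matrix.range_cons_cons_empty (L i) (L j) ![]]
  refine isNormallyFlatSection_span_range_of_homogeneousSubmodule_one_le_span
    (by simpa using hcard i j hij) ?_
  rw [hX]
  exact hy ⟨(i, j), hij⟩

end General

theorem corollary3p5_general {k σ κ : Type*} [Field k] [Infinite k] [Finite σ] [Fintype κ]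
    (L : κ → MvPolynomial σ k) (hhom : ∀ i, (L i).IsHomogeneous 1) (hne : ∀ i, L i ≠ 0)
    (hli : ∀ i j, i ≠ j → LinearIndependent k ![L i, L j])
    (hκ : (Fintype.card κ : k) = 0 → IsEmpty κ) (b : Ideal (MvPolynomial σ k) → ℕ)
    (hb_two : ∀ p ∈ (gradientIdeal (∏ i, L i)).minimalPrimes, incidenceNumber L p = 2 → b p = 1)
    (hb_other : ∀ p ∈ (gradientIdeal (∏ i, L i)).minimalPrimes,
      incidenceNumber L p ≠ 2 → b p ≤ incidenceNumber L p)
    (hfactor : ∀ i, ∀ p ∈ (gradientIdeal (∏ i, L i)).minimalPrimes,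
      ∀ q ∈ (gradientIdeal (∏ i, L i)).minimalPrimes, 3 ≤ incidenceNumber L p →
        3 ≤ incidenceNumber L q → L i ∈ p → L i ∈ q → p = q) :
    IsCohenMacaulayRing
      (MvPolynomial σ k ⧸ ⨅ p ∈ (gradientIdeal (∏ i, L i)).minimalPrimes, p ^ b p) := by
  obtain hκ0 | hκ0 := eq_or_ne (Fintype.card κ : k) 0
  · have := hκ hκ0
    have hb p (hp : p ∈ (gradientIdeal (∏ i, L i)).minimalPrimes) : p ^ b p = ⊤ := by
      have h0 : incidenceNumber L p = 0 := by simp [incidenceNumber, Set.eq_empty_of_isEmpty]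
      have hbp := hb_other p hp (by simp [h0])
      rw [h0, Nat.le_zero] at hbp
      rw [hbp, pow_zero, Ideal.one_eq_top]
    have : Subsingleton (MvPolynomial σ k ⧸
        ⨅ p ∈ (gradientIdeal (∏ i, L i)).minimalPrimes, p ^ b p) :=
      Ideal.Quotient.subsingleton_iff.2 (by simp +contextual only [hb, iInf_top])
    exact isCohenMacaulayRing_of_subsingleton _
  · obtain ⟨m, _, hsec⟩ := exists_algebra_isNormallyFlatSection hhom hli
    have hanti : IsAntichain (· ≤ ·) (pairIdeals L) := fun p hp q hq hpq hle =>
      hpq ((hsec q hq).eq_of_le (hsec p hp) hle)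
    rw [minimalPrimes_gradientIdeal_prod hhom hne hκ0 (fun p hp => (hsec p hp).isPrime) hanti] at *
    have := projective_quotient_iInf_pow_pairIdeals hsec hb_two hb_other
      fun i p hp q hq => hfactor i p hp.1 q hq.1 hp.2 hq.2
    have := isIntegral_quotient_biInf_pow (finite_pairIdeals L)
      (fun p hp => (hsec p hp).isIntegral_quotient) b
    exact isCohenMacaulayRing_of_flat_of_isIntegral k m _

theorem corollary3p5 {k : Type*} [Field k] [CharZero k] {d : ℕ}
    (L : Fin d → PlaneArrangement.CoordRing k) (hL : PlaneArrangement.IsArrangement L)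
    (b : Ideal (PlaneArrangement.CoordRing k) → ℕ)
    (hb_two : ∀ p ∈ (PlaneArrangement.arrangementIdeal L).minimalPrimes,
      PlaneArrangement.numFactors L p = 2 → b p = 1)
    (hb_other : ∀ p ∈ (PlaneArrangement.arrangementIdeal L).minimalPrimes,
      PlaneArrangement.numFactors L p ≠ 2 → b p ≤ PlaneArrangement.numFactors L p)
    (hfactor : ∀ i : Fin d,
      ∀ p ∈ (PlaneArrangement.arrangementIdeal L).minimalPrimes,
      ∀ q ∈ (PlaneArrangement.arrangementIdeal L).minimalPrimes,
        3 ≤ PlaneArrangement.numFactors L p → 3 ≤ PlaneArrangement.numFactors L q →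
        L i ∈ p → L i ∈ q → p = q) :
    IsCohenMacaulayRing
      (PlaneArrangement.CoordRing k ⧸ PlaneArrangement.fatIdeal L b) :=
  corollary3p5_general L hL.isHomogeneous hL.ne_zero hL.linearIndependent
    (by simpa using fun h => h ▸ Fin.isEmpty) b hb_two hb_other hfactor
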